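/- Let $\Sigma=\{0,1,\dots,c\}$ be a finite alphabet and let $P$ be the law on $\Sigma^{\mathbb Z}$ of a stationary mixing Markov chain of memory one. Assume that the probabilities $P(w)$ of the words $w\in\Sigma^*$ are uniformly computable real numbers, and that the conditional probability $P(x[1]=0\mid x[0]=0)$ is defined and lies strictly between $0$ and $1$, i.e. $0<P(00)<P(0)$. A Schnorr layering of $(\Sigma^{\mathbb Z},P)$ is a sequence of sets $K_r\subseteq\Sigma^{\mathbb Z}$, $r\in\mathbb N$, whose complements $U_r$ form a Schnorr test: the $U_r$ are uniformly effectively open (unions of uniformly computably enumerable families of cylinders), $P(U_r)<2^{-r}$, and the reals $P(U_r)$ are computable uniformly in $r$. For $x\in\Sigma^{\mathbb Z}$, replace by a blank $\sqcup$ every non-zero symbol and every $0$ that forms a maximal block of zeros of length $1$. For $N\ge 1$, a skeleton delimited by $N$ zeros and centered at $x[0]$ is a shortest substring of $x$ containing position $0$ whose pattern has the form $0^{n_0}\sqcup^{\ell_1}0^{n_1}\cdots\sqcup^{\ell_k}0^{n_k}$ with $k\ge1$, all $\ell_i\ge1$, $n_i\ge2$ for $1\le i\le k$, $n_i<N$ for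 $1\le i\le k-1$, and $n_0,n_k\ge N$. Its length is the number of positions in the substring that carry a non-zero symbol of $x$. Let $(L_r)_{r\ge1}$ be a computable non-decreasing sequence of positive integers. Then there are a Schnorr layering $(K'_r)$ of $(\Sigma^{\mathbb Z},P)$ and a computable strictly increasing sequence of positive integers $(N_r)_{r\ge0}$ such that for every $r\ge1$ and every $x\in K'_r$: there is a skeleton delimited by $N_r$ zeros (a skeleton of rank $r$) centered at $x[0]$, and every such skeleton has length at least $L_r$; in particular it contains at least $L_r$ blanks. -/

import Mathlib

open MeasureTheory Filter Topology
open scoped NNReal ENNReal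

namespace SchnorrSkeleton

/-! ### Two-sided sequences over the alphabet `{0, 1, …, c}` -/

/-- The space of two-sided sequences over the finite alphabet `{0, 1, …, c}`, with its product
topology and product σ-algebra. -/
abbrev Seq (c : ℕ) : Type := ℤ → Fin (c + 1)

/-- The left shift. -/
def shift {c : ℕ} (x : Seq c) : Seq c := fun i => x (i + 1)

/-- The cylinder of all `x` in which the word `w` is read from position `-n` on,
that is `x[-n] = w[0]`, `x[-n+1] = w[1]`, and so on. -/
def cyl {c : ℕ} (n : ℕ) (w : List (Fin (c + 1))) : Set (Seq c) :=
  {x | ∀ i : Fin w.length, x ((i : ℤ) - (n : ℤ)) = w.get i}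

/-! ### Computable reals, computable measures and mixing Markov measures -/

/-- A family of nonnegative reals is uniformly computable if some algorithm produces, from `a` and
`n`, a rational number (given by numerator `p` and denominator `q + 1`) that approximates `f a`
with error at most `2⁻ⁿ`. -/
def UniformlyComputableReal {α : Type} [Primcodable α] (f : α → ℝ≥0) : Prop :=
  ∃ g : α × ℕ → ℕ × ℕ, Computable g ∧
    ∀ (a : α) (n : ℕ),
      |((g (a, n)).1 : ℝ) / (((g (a, n)).2 : ℝ) + 1) - (f a : ℝ)| ≤ (1 / 2 : ℝ) ^ n

/-- The probabilities of finite words, read from position `0` on, are uniformly computable. -/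
def ComputableWordProbabilities {c : ℕ} (μ : Measure (Seq c)) : Prop :=
  UniformlyComputableReal fun w : List (Fin (c + 1)) => (μ (cyl 0 w)).toNNReal

/-- `μ` is the law of a stationary mixing Markov chain (of memory one) with values in
`{0, 1, …, c}`. -/
structure IsMixingMarkov {c : ℕ} (μ : Measure (Seq c)) : Prop where
  prob : IsProbabilityMeasure μ
  stationary : MeasurePreserving shift μ μ
  /-- `P(b ∣ w a) = P(b ∣ a)`, with the denominators cleared. -/
  markov : ∀ (w : List (Fin (c + 1))) (a b : Fin (c + 1)),
    μ (cyl 0 (w ++ [a, b])) * μ (cyl 0 [a]) = μ (cyl 0 (w ++ [a])) * μ (cyl 0 [a, b])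
  mixing : ∀ A B : Set (Seq c), MeasurableSet A → MeasurableSet B →
    Tendsto (fun n : ℕ => μ (A ∩ shift^[n] ⁻¹' B)) atTop (𝓝 (μ A * μ B))

/-! ### Schnorr layerings -/

/-- Uniformly effectively open sets: each `U r` is a union of cylinders, whose codes are
computably enumerable uniformly in `r`. -/
def UniformlyEffectivelyOpen {c : ℕ} (U : ℕ → Set (Seq c)) : Prop :=
  ∃ E : ℕ × (ℕ × List (Fin (c + 1))) → Prop, REPred E ∧
    ∀ r, U r = ⋃ p ∈ {p : ℕ × List (Fin (c + 1)) | E (r, p)}, cyl p.1 p.2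

/-- A Schnorr test: uniformly effectively open sets `U r` of uniformly computable measure
less than `2⁻ʳ`. -/
structure IsSchnorrTest {c : ℕ} (μ : Measure (Seq c)) (U : ℕ → Set (Seq c)) : Prop where
  effectivelyOpen : UniformlyEffectivelyOpen U
  measure_lt : ∀ r, μ (U r) < (2⁻¹ : ℝ≥0∞) ^ r
  computable_measure : UniformlyComputableReal fun r => (μ (U r)).toNNReal

/-- A Schnorr layering: the complements of the layers form a Schnorr test. -/
def IsSchnorrLayering {c : ℕ} (μ : Measure (Seq c)) (K : ℕ → Set (Seq c)) : Prop :=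
  IsSchnorrTest μ fun r => (K r)ᶜ

/-! ### Skeletons

In a skeleton every non-zero symbol and every stand-alone `0` becomes a blank. A remaining `0` is
coded by `true`, a blank by `false`. -/

/-- The skeleton symbol of `x` at position `j`: `true` if `x[j]` is a `0` in a maximal block of
at least two `0`s, and `false` (a blank) otherwise. -/
def mark {c : ℕ} (x : Seq c) (j : ℤ) : Bool :=
  decide (x j = 0 ∧ (x (j - 1) = 0 ∨ x (j + 1) = 0))

/-- The pattern of `0`s and blanks of the substring of `x` of `n` symbols starting at `a`. -/
def pattern {c : ℕ} (x : Seq c) (a : ℤ) (n : ℕ) : List Bool :=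
  (List.range n).map fun i : ℕ => mark x (a + (i : ℤ))

/-- `s` has the form `0^{n₀} ␣^{ℓ₁} 0^{n₁} … ␣^{ℓₖ} 0^{nₖ}` with `k ≥ 1`, all `ℓᵢ ≥ 1`,
`nᵢ ≥ 2` for `1 ≤ i ≤ k`, `nᵢ < N` for `1 ≤ i ≤ k - 1`, and `n₀, nₖ ≥ N`.
The list `p` consists of the pairs `(ℓᵢ, nᵢ)` with `i < k`, and `(l, m)` is `(ℓₖ, nₖ)`. -/
def HasSkeletonForm (N : ℕ) (s : List Bool) : Prop :=
  ∃ (n₀ : ℕ) (p : List (ℕ × ℕ)) (l m : ℕ),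
    s = List.replicate n₀ true ++
        p.flatMap (fun q => List.replicate q.1 false ++ List.replicate q.2 true) ++
        (List.replicate l false ++ List.replicate m true) ∧
    N ≤ n₀ ∧ (∀ q ∈ p, 1 ≤ q.1 ∧ 2 ≤ q.2 ∧ q.2 < N) ∧ 1 ≤ l ∧ 2 ≤ m ∧ N ≤ m

/-- The substring of `x` of `n` symbols starting at `a` contains position `i` and has the form of
a skeleton delimited by blocks of at least `N` zeros. -/
def IsSkeletonWindow {c : ℕ} (N : ℕ) (x : Seq c) (i a : ℤ) (n : ℕ) : Prop :=
  a ≤ i ∧ i < a + (n : ℤ) ∧ HasSkeletonForm N (pattern x a n)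

/-- The substring of `x` of `n` symbols starting at `a` is a skeleton centered at `x[i]` and
delimited by (at least) `N` zeros: it is a shortest such substring around position `i`. -/
def IsSkeletonAt {c : ℕ} (N : ℕ) (x : Seq c) (i a : ℤ) (n : ℕ) : Prop :=
  IsSkeletonWindow N x i a n ∧
    ∀ (a' : ℤ) (n' : ℕ), IsSkeletonWindow N x i a' n' → n ≤ n'

/-- The length of a skeleton occupying the `n` positions from `a` on: the number of those
positions that carry a non-zero symbol. -/
def skeletonLength {c : ℕ} (x : Seq c) (a : ℤ) (n : ℕ) : ℕ :=
  ((Finset.range n).filter fun k : ℕ => x (a + (k : ℤ)) ≠ 0).card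

end SchnorrSkeleton

namespace SchnorrSkeleton

/-! ### Computable sums and searches -/

/-! The layers are taken to be clopen sets `goodSet c l d N M`. Each of `l + 1` consecutive blocks
of `d` positions to the right of 0 carries a non-zero symbol, and so does the block of `d` positions
to the left. Further out, within distance `M`, there are `N` consecutive zeros on either side.

If `N ≥ 2(l+1)d + 2`, this forces the conclusion. The nearest runs of `N` zeros on the two sides
bound a window with no such run between them, so a skeleton exists. Conversely, a delimiter of any
window around 0 cannot cross the non-zero symbols next to 0, so by its length the window reaches
over all the inspected blocks on the right and picks up `l` non-zero symbols (`exists_isSkeletonAt`,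
`le_skeletonLength_of_isSkeletonWindow`).

The complement can be made small by choosing `d`, then `N` from `d`, then `M`. By the Markov
property the probability of `d` zeros decays geometrically, because `P(00) < P(0)`. Since `P(00) >
0`, runs of `N` zeros have positive probability, and mixing makes them occur almost surely on both
sides (`exists_measure_compl_goodSet_lt`).

Effectivity comes from clopenness: the measure of the complement is a finite sum of word
probabilities, hence computable uniformly in the parameters. Suitable `d` and `M` are found by
unbounded search, rank after rank, each rank receiving the previous delimiter
(`exists_computable_parameters`). -/

theorem computable_list_map_sum {α β : Type} [Primcodable α] [Primcodable β]
    {l : α → List β} {h : α × β → ℕ} (hl : Computable l) (hh : Computable h) :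
    Computable fun a => ((l a).map fun b => h (a, b)).sum := by
  -- Recursion on the index into the list. The default `0` is never used, since the index stays
  -- below the length.
  have hstep : Computable₂ fun (a : α) (p : ℕ × ℕ) =>
      p.2 + Option.casesOn (l a)[p.1]? 0 (fun b => h (a, b)) := by
    refine Primrec.nat_add.to_comp.comp (Computable.snd.comp Computable.snd) ?_
    refine Computable.option_casesOn
      (Computable.list_getElem?.comp (hl.comp Computable.fst)
        (Computable.fst.comp Computable.snd)) (Computable.const 0) ?_
    exact hh.comp ((Computable.fst.comp Computable.fst).pair Computable.snd)
  have hrec := Computable.nat_rec (Computable.list_length.comp hl) (Computable.const 0) hstep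
  refine hrec.of_eq fun a => ?_
  have key : ∀ n, n ≤ (l a).length →
      (Nat.rec 0 (fun y IH => IH + Option.casesOn (l a)[y]? 0 (fun b => h (a, b))) n : ℕ) =
        (((l a).take n).map fun b => h (a, b)).sum := by
    intro n
    induction n with
    | zero => intro _; simp
    | succ n ih =>
      intro hn
      have hn' : n < (l a).length := hn
      rw [List.take_succ_eq_append_getElem hn', List.map_append, List.sum_append,
        ← ih hn'.le]
      simp [List.getElem?_eq_getElem hn']
  have := key (l a).length le_rfl
  rw [List.take_length] at this
  exact this

theorem UniformlyComputableReal.comp {α β : Type} [Primcodable α] [Primcodable β]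
    {f : β → ℝ≥0} (hf : UniformlyComputableReal f) {s : α → β} (hs : Computable s) :
    UniformlyComputableReal fun a => f (s a) := by
  obtain ⟨g, hg, hgf⟩ := hf
  exact ⟨fun p => g (s p.1, p.2),
    hg.comp ((hs.comp Computable.fst).pair Computable.snd), fun a n => hgf (s a) n⟩

theorem primrec_two_pow : Primrec fun n : ℕ => 2 ^ n := by
  have hstep : Primrec₂ fun _ b : ℕ => b * 2 :=
    Primrec.nat_mul.comp Primrec.snd (Primrec.const 2)
  refine (Primrec.nat_rec₁ 1 hstep).of_eq fun n => ?_
  induction n with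
  | zero => rfl
  | succ n ih => rw [pow_succ, ← ih]

/-- A uniformly computable real has uniformly computable dyadic approximations. -/
theorem UniformlyComputableReal.exists_dyadic {β : Type} [Primcodable β] {f : β → ℝ≥0}
    (hf : UniformlyComputableReal f) :
    ∃ h : β × ℕ → ℕ, Computable h ∧
      ∀ b n, |(h (b, n) : ℝ) / 2 ^ n - (f b : ℝ)| ≤ 2 * (1 / 2 : ℝ) ^ n := by
  obtain ⟨g, hg, hgf⟩ := hf
  -- Rounding the given fraction down to a multiple of `2⁻ⁿ` costs a second `2⁻ⁿ`, whence the factor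
  -- 2 in the error.
  refine ⟨fun p => (g p).1 * 2 ^ p.2 / ((g p).2 + 1), ?_, fun b n => ?_⟩
  · refine Primrec.nat_div.to_comp.comp
      (Primrec.nat_mul.to_comp.comp (Computable.fst.comp hg)
        (primrec_two_pow.to_comp.comp Computable.snd))
      (Computable.succ.comp (Computable.snd.comp hg))
  · have h1 := hgf b n
    set p := (g (b, n)).1
    set q := (g (b, n)).2
    have hq : (0 : ℝ) < (q : ℝ) + 1 := by positivity
    have h2n : (0 : ℝ) < 2 ^ n := by positivity
    have hlo : ((p * 2 ^ n / (q + 1) : ℕ) : ℝ) ≤ (p : ℝ) * 2 ^ n / ((q : ℝ) + 1) := by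
      have := @Nat.cast_div_le ℝ _ _ _ (p * 2 ^ n) (q + 1)
      push_cast at this
      exact this
    have hhi : (p : ℝ) * 2 ^ n / ((q : ℝ) + 1) < ((p * 2 ^ n / (q + 1) : ℕ) : ℝ) + 1 := by
      rw [div_lt_iff₀ hq]
      have := Nat.lt_div_mul_add (a := p * 2 ^ n) (b := q + 1) (Nat.succ_pos q)
      have h3 : p * 2 ^ n < (p * 2 ^ n / (q + 1) + 1) * (q + 1) := by
        rw [add_mul, one_mul]; exact this
      exact_mod_cast h3
    have hlo' : ((p * 2 ^ n / (q + 1) : ℕ) : ℝ) / 2 ^ n ≤ (p : ℝ) / ((q : ℝ) + 1) := by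
      rw [div_le_iff₀ h2n]
      calc _ ≤ _ := hlo
        _ = _ := by ring
    have hhi' : (p : ℝ) / ((q : ℝ) + 1) ≤
        ((p * 2 ^ n / (q + 1) : ℕ) : ℝ) / 2 ^ n + (1 / 2 : ℝ) ^ n := by
      rw [one_div, inv_pow, ← one_div, ← add_div, le_div_iff₀ h2n]
      calc _ = (p : ℝ) * 2 ^ n / ((q : ℝ) + 1) := by ring
        _ ≤ _ := hhi.le
    rw [abs_le] at h1 ⊢
    have : (0 : ℝ) < (1 / 2 : ℝ) ^ n := by positivity
    constructor <;> simp only [] <;> linarith [h1.1, h1.2]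

/-- With the common denominator `2 ^ m` the numerators simply add up, and the error is at most the
number of terms times `2 * 2⁻ᵐ`. As a length `k` is at most `2 ^ k`, precision `n + k + 1` is
enough. -/
theorem UniformlyComputableReal.list_sum {α β : Type} [Primcodable α] [Primcodable β]
    {f : β → ℝ≥0} (hf : UniformlyComputableReal f) {l : α → List β} (hl : Computable l) :
    UniformlyComputableReal fun a => ((l a).map f).sum := by
  obtain ⟨h, hh, hhf⟩ := hf.exists_dyadic
  let prec : α × ℕ → ℕ := fun p => p.2 + ((l p.1).length + 1)
  have hprec : Computable prec :=
    Primrec.nat_add.to_comp.comp Computable.snd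
      (Computable.succ.comp (Computable.list_length.comp (hl.comp Computable.fst)))
  refine ⟨fun p => (((l p.1).map fun b => h (b, prec p)).sum, 2 ^ prec p - 1), ?_, ?_⟩
  · refine Computable.pair ?_ ?_
    · exact computable_list_map_sum (h := fun q : (α × ℕ) × β => h (q.2, prec q.1))
        (hl.comp Computable.fst)
        (hh.comp (Computable.snd.pair (hprec.comp Computable.fst)))
    · exact Primrec.nat_sub.to_comp.comp (primrec_two_pow.to_comp.comp hprec)
        (Computable.const 1)
  · intro a n
    have key : ∀ (m : ℕ) (t : List β),
        |(((t.map fun b => h (b, m)).sum : ℕ) : ℝ) / 2 ^ m - ((t.map f).sum : ℝ≥0)| ≤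
          t.length * (2 * (1 / 2 : ℝ) ^ m) := by
      intro m t
      induction t with
      | nil => simp
      | cons b t ih =>
        have hb := hhf b m
        simp only [List.map_cons, List.sum_cons, Nat.cast_add, NNReal.coe_add, List.length_cons,
          Nat.cast_one]
        rw [abs_le] at *
        constructor <;> rw [add_div] <;> linarith [ih.1, ih.2, hb.1, hb.2]
    have hk := key (prec (a, n)) (l a)
    have hden : (((2 ^ prec (a, n) - 1 : ℕ) : ℝ) + 1) = 2 ^ prec (a, n) := by
      rw [Nat.cast_sub Nat.one_le_two_pow]; push_cast; ring
    simp only [hden]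
    refine hk.trans ?_
    have hlen : ((l a).length : ℝ) ≤ 2 ^ (l a).length := by
      exact_mod_cast Nat.lt_two_pow_self.le
    have : (2 * (1 / 2 : ℝ) ^ prec (a, n)) = (1 / 2 : ℝ) ^ n * (1 / 2 : ℝ) ^ (l a).length := by
      simp only [prec, pow_add, pow_one]; ring
    rw [this, mul_left_comm]
    refine mul_le_of_le_one_right (by positivity) ?_
    rw [one_div, inv_pow, ← div_eq_mul_inv, div_le_one (by positivity)]
    exact hlen

/-- If some parameter makes a uniformly computable real small, then one can be found
computably. -/
theorem UniformlyComputableReal.exists_computable_lt {α : Type} [Primcodable α]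
    {f : α × ℕ → ℝ≥0} (hf : UniformlyComputableReal f) {e : α → ℕ} (he : Computable e)
    (hsmall : ∀ a, ∃ n, (f (a, n) : ℝ) < (1 / 2 : ℝ) ^ (e a + 2)) :
    ∃ s : α → ℕ, Computable s ∧ ∀ a, (f (a, s a) : ℝ) < (1 / 2 : ℝ) ^ e a := by
  obtain ⟨g, hg, hgf⟩ := hf
  let v : α × ℕ → ℕ × ℕ := fun p => g (p, e p.1 + 2)
  have hv : Computable v :=
    hg.comp (Computable.id.pair
      (Computable.succ.comp (Computable.succ.comp (he.comp Computable.fst))))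
  -- A decidable test: is the rational approximation, of error `2^-(e+2)`, below `2^-(e+1)`? It
  -- succeeds once the real is below `2^-(e+2)`, and success bounds the real by `2^-(e+1) + 2^-(e+2)
  -- < 2^-e`.
  let t : α → ℕ → Bool := fun a n => decide ((v (a, n)).1 * 2 ^ (e a + 1) < (v (a, n)).2 + 1)
  have ht : Computable₂ t := by
    have hlt : Computable fun p : ℕ × ℕ => decide (p.1 < p.2) :=
      (Primrec.nat_lt.decide).to_comp
    refine hlt.comp (Computable.pair
      (Primrec.nat_mul.to_comp.comp (Computable.fst.comp hv)
        (primrec_two_pow.to_comp.comp (Computable.succ.comp (he.comp Computable.fst))))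
      (Computable.succ.comp (Computable.snd.comp hv)))
  have htest : ∀ a n, t a n = true ↔
      ((v (a, n)).1 : ℝ) / (((v (a, n)).2 : ℝ) + 1) < (1 / 2 : ℝ) ^ (e a + 1) := by
    intro a n
    have hq : (0 : ℝ) < ((v (a, n)).2 : ℝ) + 1 := by positivity
    rw [div_lt_iff₀ hq, one_div, inv_pow, inv_mul_eq_div, lt_div_iff₀ (by positivity)]
    simp only [t, decide_eq_true_eq]
    exact_mod_cast Iff.rfl
  have hdom : ∀ a, (Nat.rfind fun n => Part.some (t a n)).Dom := by
    intro a
    obtain ⟨n, hn⟩ := hsmall a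
    have : t a n = true := by
      rw [htest]
      have h1 := (abs_le.1 (hgf (a, n) (e a + 2))).2
      have h2 : (1 / 2 : ℝ) ^ (e a + 1) = (1 / 2 : ℝ) ^ (e a + 2) + (1 / 2 : ℝ) ^ (e a + 2) := by
        rw [pow_succ _ (e a + 1)]; ring
      simp only [v]
      linarith
    obtain ⟨m, hm, -⟩ := Nat.rfind_min' (p := t a) this
    exact Part.dom_iff_mem.2 ⟨m, hm⟩
  refine ⟨fun a => (Nat.rfind fun n => Part.some (t a n)).get (hdom a), ?_, fun a => ?_⟩
  · have : Partrec fun a => Nat.rfind fun n => Part.some (t a n) := Partrec.rfind ht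
    exact this.of_eq fun a => (Part.some_get (hdom a)).symm
  · set m := (Nat.rfind fun n => Part.some (t a n)).get (hdom a) with hm
    have hspec := Nat.rfind_spec (Part.get_mem (hdom a))
    have h0 : t a m = true := (Part.mem_some_iff.1 hspec).symm
    rw [htest] at h0
    have h1 := (abs_le.1 (hgf (a, m) (e a + 2))).1
    have h2 : (1 / 2 : ℝ) ^ (e a + 1) = (1 / 2 : ℝ) ^ e a / 2 := by rw [pow_succ]; ring
    have h3 : (1 / 2 : ℝ) ^ (e a + 2) = (1 / 2 : ℝ) ^ e a / 4 := by rw [pow_add]; ring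
    have h4 : (0 : ℝ) < (1 / 2 : ℝ) ^ e a := by positivity
    rw [h2] at h0
    rw [h3] at h1
    simp only [v] at h0
    rw [h3.symm] at h1
    linarith

/-! ### Patterns and skeleton windows -/

theorem pattern_add {c : ℕ} (x : Seq c) (a : ℤ) (m n : ℕ) :
    pattern x a (m + n) = pattern x a m ++ pattern x (a + m) n := by
  simp [pattern, List.range_add, Function.comp_def, add_assoc]

theorem pattern_eq_replicate {c : ℕ} {x : Seq c} {a : ℤ} {n : ℕ} {b : Bool}
    (h : ∀ i < n, mark x (a + (i : ℤ)) = b) : pattern x a n = List.replicate n b := by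
  rw [List.eq_replicate_iff]
  refine ⟨by simp [pattern], fun t ht => ?_⟩
  simp only [pattern, List.mem_map, List.mem_range] at ht
  obtain ⟨i, hi, rfl⟩ := ht
  exact h i hi

theorem mark_eq_of_pattern {c : ℕ} {x : Seq c} {a : ℤ} {n : ℕ} {s t : List Bool} {k : ℕ} {b : Bool}
    (h : pattern x a n = s ++ List.replicate k b ++ t) {i : ℕ} (hi : i < k) :
    mark x (a + ((s.length + i : ℕ) : ℤ)) = b := by
  have hlen : n = s.length + k + t.length := by
    have := congrArg List.length h
    simpa [pattern, add_assoc] using this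
  have h1 : (pattern x a n)[s.length + i]? = some (mark x (a + ((s.length + i : ℕ) : ℤ))) := by
    simp only [pattern, List.getElem?_map]
    rw [List.getElem?_range (by omega)]
    rfl
  rw [h, List.append_assoc, List.getElem?_append_right (by omega),
    List.getElem?_append_left (by simp; omega)] at h1
  simpa [List.getElem?_replicate, hi] using h1.symm

theorem eq_zero_of_mark {c : ℕ} {x : Seq c} {j : ℤ} (h : mark x j = true) : x j = 0 := by
  simp only [mark, decide_eq_true_eq] at h
  exact h.1

/-- The interior of a skeleton together with its last block of blanks. -/
def IsSkeletonInterior (N : ℕ) (s : List Bool) : Prop :=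
  ∃ (p : List (ℕ × ℕ)) (l : ℕ),
    s = p.flatMap (fun q => List.replicate q.1 false ++ List.replicate q.2 true) ++
        List.replicate l false ∧
    (∀ q ∈ p, 1 ≤ q.1 ∧ 2 ≤ q.2 ∧ q.2 < N) ∧ 1 ≤ l

theorem IsSkeletonInterior.blank_cons {N : ℕ} {s : List Bool} (h : IsSkeletonInterior N s) :
    IsSkeletonInterior N (false :: s) := by
  obtain ⟨p, l, rfl, hp, hl⟩ := h
  cases p with
  | nil => exact ⟨[], l + 1, by simp [List.replicate_succ], by simp, by omega⟩
  | cons q p =>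
    refine ⟨(q.1 + 1, q.2) :: p, l, by simp [List.replicate_succ], ?_, hl⟩
    intro q' hq'
    rcases List.mem_cons.1 hq' with rfl | hq'
    · have := hp q (by simp)
      simp only
      omega
    · exact hp q' (by simp [hq'])

theorem IsSkeletonInterior.block_cons {N k : ℕ} {s : List Bool} (h : IsSkeletonInterior N s)
    (h2 : 2 ≤ k) (hk : k < N) :
    IsSkeletonInterior N (false :: (List.replicate k true ++ s)) := by
  obtain ⟨p, l, rfl, hp, hl⟩ := h
  refine ⟨(1, k) :: p, l, by simp, ?_, hl⟩
  intro q hq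
  rcases List.mem_cons.1 hq with rfl | hq
  · exact ⟨le_rfl, h2, hk⟩
  · exact hp q hq

/-- Strong induction on the length: peel off the leading blank and the `k` marked zeros up to the
next blank. The last hypothesis, that every stretch of `N` positions has a blank, gives `k < N`; the
definition of `mark` excludes `k = 1`. -/
theorem isSkeletonInterior_pattern {c N : ℕ} {x : Seq c} (n : ℕ) : ∀ a : ℤ,
    mark x a = false → mark x (a + n) = false →
    (∀ k : ℕ, a + k + N ≤ a + n → ∃ i < N, mark x (a + k + (i : ℤ)) = false) →
    IsSkeletonInterior N (pattern x a (n + 1)) := by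
  induction n using Nat.strong_induction_on with
  | _ n ih =>
    intro a ha hb hrun
    have hone : pattern x a 1 = [false] := by simp [pattern, ha]
    rcases Nat.eq_zero_or_pos n with rfl | hn
    · exact ⟨[], 1, by simpa using hone, by simp, le_rfl⟩
    · have hex : ∃ k : ℕ, mark x (a + 1 + (k : ℤ)) = false :=
        ⟨n - 1, by rw [← hb]; congr 1; omega⟩
      obtain ⟨k, hkn, hkf, hkt⟩ : ∃ k : ℕ, k ≤ n - 1 ∧ mark x (a + 1 + (k : ℤ)) = false ∧
          ∀ i < k, mark x (a + 1 + (i : ℤ)) = true := by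
        classical
        exact ⟨Nat.find hex, Nat.find_min' hex (by rw [← hb]; congr 1; omega),
          Nat.find_spec hex, fun i hi => by simpa using Nat.find_min hex hi⟩
      obtain ⟨m, hm⟩ : ∃ m, n = 1 + k + m := ⟨n - 1 - k, by omega⟩
      have hrec : IsSkeletonInterior N (pattern x (a + 1 + (k : ℤ)) (m + 1)) := by
        refine ih m (by omega) _ hkf ?_ ?_
        · rw [← hb]; congr 1; omega
        · intro j hj
          obtain ⟨i, hi, h⟩ := hrun (1 + k + j) (by push_cast; omega)
          refine ⟨i, hi, ?_⟩
          rw [← h]; congr 1; push_cast; ring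
      have hsplit : pattern x a (n + 1) =
          false :: (List.replicate k true ++ pattern x (a + 1 + (k : ℤ)) (m + 1)) := by
        rw [show n + 1 = 1 + (k + (m + 1)) by omega, pattern_add, hone, pattern_add,
          Nat.cast_one, pattern_eq_replicate hkt]
        rfl
      rw [hsplit]
      rcases Nat.eq_zero_or_pos k with hk0 | hkpos
      · rw [hk0] at hrec ⊢
        rw [Nat.cast_zero, add_zero] at hrec ⊢
        exact hrec.blank_cons
      · refine hrec.block_cons ?_ ?_
        -- A marked zero has a zero neighbour, which is then marked as well, so it cannot stand
        -- between two blanks.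
        · by_contra hlt
          have hk1 : k = 1 := by omega
          have h1 := hkt 0 hkpos
          rw [hk1] at hkf
          simp only [mark, decide_eq_true_eq, decide_eq_false_iff_not, Nat.cast_zero, add_zero,
            Nat.cast_one] at h1 ha hkf
          obtain ⟨h10, h1 | h1⟩ := h1
          · apply ha
            rw [add_sub_cancel_right] at h1
            exact ⟨h1, Or.inr h10⟩
          · apply hkf
            refine ⟨h1, Or.inl ?_⟩
            rw [add_sub_cancel_right]; exact h10
        · by_contra hge
          obtain ⟨i, hi, h⟩ := hrun 1 (by push_cast; omega)
          rw [Nat.cast_one, hkt i (by omega)] at h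
          exact Bool.noConfusion h

theorem IsSkeletonInterior.hasSkeletonForm {N : ℕ} {s : List Bool} (h : IsSkeletonInterior N s)
    (hN : 2 ≤ N) :
    HasSkeletonForm N (List.replicate N true ++ s ++ List.replicate N true) := by
  obtain ⟨p, l, rfl, hp, hl⟩ := h
  exact ⟨N, p, l, N, by simp, le_rfl, hp, hl, hN, le_rfl⟩

/-- In a skeleton window the first and the last `N` symbols are zeros. -/
theorem HasSkeletonForm.zero_delimited {c N : ℕ} {x : Seq c} {a : ℤ} {n : ℕ}
    (h : HasSkeletonForm N (pattern x a n)) :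
    (∀ i < N, x (a + (i : ℤ)) = 0) ∧ ∀ i < N, x (a + n - 1 - (i : ℤ)) = 0 := by
  obtain ⟨n₀, p, l, m, hs, h0, -, -, -, hm⟩ := h
  have hlen := congrArg List.length hs
  constructor
  · intro i hi
    rw [List.append_assoc, ← List.nil_append (List.replicate n₀ true)] at hs
    have := mark_eq_of_pattern hs (i := i) (by omega)
    simpa using eq_zero_of_mark this
  · intro i hi
    rw [← List.append_assoc, ← List.append_nil (_ ++ List.replicate m true)] at hs
    have := eq_zero_of_mark (mark_eq_of_pattern hs (i := m - 1 - i) (by omega))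
    rw [← this]
    congr 1
    simp only [pattern, List.length_map, List.length_range, List.length_append,
      List.length_replicate] at hlen ⊢
    push_cast
    omega

/-! ### The combinatorial condition on a layer -/

/-- The condition on the zeros to the right (`zr k` stands for a zero at `1 + k`) and to the left
(`zl k` stands for a zero at `-1 - k`) of position `0`: non-zero symbols near `0`, and beyond them
blocks of `N` zeros on both sides. -/
def Good (l d N M : ℕ) (zr zl : ℕ → Prop) : Prop :=
  ((∀ i < l + 1, ∃ j < d, ¬ zr (i * d + j)) ∧ ∃ j < d, ¬ zl j) ∧
    (∃ j < M, ∀ i < N, zr (j + i)) ∧ ∃ j < M, ∀ i < N, zl (j + i)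

/-- The radius within which `Good` looks at a sequence. -/
def radius (l d N M : ℕ) : ℕ := (l + 1) * d + M + N

/-- Locality: this is what makes good sets clopen and lets them be decided on finite words. -/
theorem Good.congr {l d N M : ℕ} {zr zl zr' zl' : ℕ → Prop}
    (hr : ∀ k < radius l d N M, (zr k ↔ zr' k)) (hl : ∀ k < radius l d N M, (zl k ↔ zl' k)) :
    Good l d N M zr zl ↔ Good l d N M zr' zl' := by
  have hd : d ≤ (l + 1) * d := Nat.le_mul_of_pos_left d (Nat.succ_pos l)
  unfold radius at hr hl
  have h1 : ∀ i < l + 1, ∀ j < d, (zr (i * d + j) ↔ zr' (i * d + j)) := by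
    intro i hi j hj
    apply hr
    have : (i + 1) * d ≤ (l + 1) * d := Nat.mul_le_mul_right d hi
    rw [Nat.succ_mul] at this
    omega
  have h2 : ∀ j < d, (zl j ↔ zl' j) := fun j hj => hl j (by omega)
  have h3 : ∀ j < M, ∀ i < N, (zr (j + i) ↔ zr' (j + i)) := fun j hj i hi => hr _ (by omega)
  have h4 : ∀ j < M, ∀ i < N, (zl (j + i) ↔ zl' (j + i)) := fun j hj i hi => hl _ (by omega)
  unfold Good
  refine and_congr (and_congr ?_ ?_) (and_congr ?_ ?_)
  · exact forall₂_congr fun i hi => exists_congr fun j =>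
      and_congr_right fun hj => not_congr (h1 i hi j hj)
  · exact exists_congr fun j => and_congr_right fun hj => not_congr (h2 j hj)
  · exact exists_congr fun j => and_congr_right fun hj => forall₂_congr (h3 j hj)
  · exact exists_congr fun j => and_congr_right fun hj => forall₂_congr (h4 j hj)

/-- The sequences satisfying `Good`. -/
def goodSet (c l d N M : ℕ) : Set (Seq c) :=
  {x | Good l d N M (fun k => x (1 + (k : ℤ)) = 0) (fun k => x (-1 - (k : ℤ)) = 0)}

/-! ### From the good condition to skeletons -/

section

variable {c l d N M : ℕ} {x : Seq c}

theorem exists_ne_zero_of_mem_goodSet (hx : x ∈ goodSet c l d N M) :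
    (∃ p : ℤ, 1 ≤ p ∧ p ≤ d ∧ x p ≠ 0) ∧ ∃ q : ℤ, q ≤ -1 ∧ -(d : ℤ) ≤ q ∧ x q ≠ 0 := by
  obtain ⟨⟨h1, j, hj, h2⟩, -⟩ := hx
  obtain ⟨i, hi, h1⟩ := h1 0 (Nat.succ_pos l)
  refine ⟨⟨_, ?_, ?_, h1⟩, ⟨_, ?_, ?_, h2⟩⟩ <;> push_cast <;> omega

/-- The window is bounded by the nearest runs of `N` zeros on either side of 0. By minimality no
other run of `N` zeros lies between them, and the positions just inside are non-zero, so the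
interior has the required form. -/
theorem exists_isSkeletonWindow (hx : x ∈ goodSet c l d N M) (hN : 2 * d + 2 ≤ N) :
    ∃ a n, IsSkeletonWindow N x 0 a n := by
  classical
  obtain ⟨⟨p, hp1, hpd, hp⟩, q, hq1, hqd, hq⟩ := exists_ne_zero_of_mem_goodSet hx
  obtain ⟨-, ⟨jr', -, hjr'⟩, jl', -, hjl'⟩ := hx
  have hexr : ∃ j : ℕ, ∀ i < N, x (1 + ((j + i : ℕ) : ℤ)) = 0 := ⟨jr', hjr'⟩
  have hexl : ∃ j : ℕ, ∀ i < N, x (-1 - ((j + i : ℕ) : ℤ)) = 0 := ⟨jl', hjl'⟩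
  obtain ⟨r, hr, hrmin⟩ : ∃ r : ℕ, (∀ i < N, x (1 + ((r + i : ℕ) : ℤ)) = 0) ∧
      ∀ j < r, ¬ ∀ i < N, x (1 + ((j + i : ℕ) : ℤ)) = 0 :=
    ⟨_, Nat.find_spec hexr, fun j hj => Nat.find_min hexr hj⟩
  obtain ⟨l, hl, hlmin⟩ : ∃ l : ℕ, (∀ i < N, x (-1 - ((l + i : ℕ) : ℤ)) = 0) ∧
      ∀ j < l, ¬ ∀ i < N, x (-1 - ((j + i : ℕ) : ℤ)) = 0 :=
    ⟨_, Nat.find_spec hexl, fun j hj => Nat.find_min hexl hj⟩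
  have hr' : ∀ t : ℤ, 1 + (r : ℤ) ≤ t → t < 1 + r + N → x t = 0 := by
    intro t ht1 ht2
    have := hr (t - 1 - r).toNat (by omega)
    rw [← this]; congr 1; push_cast; omega
  have hl' : ∀ t : ℤ, t ≤ -1 - (l : ℤ) → -1 - (l : ℤ) - N < t → x t = 0 := by
    intro t ht1 ht2
    have := hl (-1 - l - t).toNat (by omega)
    rw [← this]; congr 1; push_cast; omega
  -- there is no further block of `N` zeros between the two
  have hno : ∀ s : ℤ, -(l : ℤ) - N ≤ s - 1 → s + N ≤ r + N → ∃ t, s ≤ t ∧ t < s + N ∧ x t ≠ 0 := by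
    intro s hs1 hs2
    by_contra hcon
    push Not at hcon
    by_cases h1 : 1 ≤ s
    · refine hrmin (s - 1).toNat (by omega) fun i hi => hcon _ ?_ ?_ <;> push_cast <;> omega
    · by_cases h2 : s + N ≤ 0
      · refine hlmin (-(s + N)).toNat (by omega) fun i hi => hcon _ ?_ ?_ <;> push_cast <;> omega
      -- The stretch contains 0 or starts or ends next to it; as `N ≥ 2d + 2`, it is too long to
      -- avoid both `p` and `q`.
      · by_cases h3 : p < s + N
        · exact hp (hcon p (by omega) h3)
        · exact hq (hcon q (by omega) (by omega))
  -- Otherwise the left run, moved inward by one position, would be a forbidden run.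
  have hlend : x (-(l : ℤ)) ≠ 0 := by
    intro h0
    obtain ⟨t, ht1, ht2, ht⟩ := hno (-(l : ℤ) + 1 - N) (by omega) (by omega)
    by_cases h : t = -(l : ℤ)
    · exact ht (h ▸ h0)
    · exact ht (hl' t (by omega) (by omega))
  have hrend : x (r : ℤ) ≠ 0 := by
    intro h0
    obtain ⟨t, ht1, ht2, ht⟩ := hno (r : ℤ) (by omega) (by omega)
    by_cases h : t = (r : ℤ)
    · exact ht (h ▸ h0)
    · exact ht (hr' t (by omega) (by omega))
  have hmark : ∀ t : ℤ, x t ≠ 0 → mark x t = false := fun t ht => by simp [mark, ht]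
  have hint : IsSkeletonInterior N (pattern x (-(l : ℤ)) (l + r + 1)) := by
    refine isSkeletonInterior_pattern (l + r) _ (hmark _ hlend) ?_ ?_
    · rw [← hmark _ hrend]; congr 1; push_cast; omega
    · intro k hk
      obtain ⟨t, ht1, ht2, ht⟩ := hno (-(l : ℤ) + k) (by omega) (by push_cast at hk; omega)
      refine ⟨(t - (-(l : ℤ) + k)).toNat, by omega, ?_⟩
      rw [← hmark t ht]; congr 1; omega
  have hleft : pattern x (-(l : ℤ) - N) N = List.replicate N true := by
    refine pattern_eq_replicate fun i hi => ?_
    simp only [mark, decide_eq_true_eq]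
    refine ⟨hl' _ (by omega) (by omega), ?_⟩
    by_cases h : i = 0
    · exact Or.inr (hl' _ (by omega) (by omega))
    · exact Or.inl (hl' _ (by omega) (by omega))
  have hright : pattern x (1 + (r : ℤ)) N = List.replicate N true := by
    refine pattern_eq_replicate fun i hi => ?_
    simp only [mark, decide_eq_true_eq]
    refine ⟨hr' _ (by omega) (by omega), ?_⟩
    by_cases h : i = 0
    · exact Or.inr (hr' _ (by omega) (by omega))
    · exact Or.inl (hr' _ (by omega) (by omega))
  refine ⟨-(l : ℤ) - N, N + (l + r + 1) + N, by omega, by push_cast; omega, ?_⟩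
  rw [pattern_add, pattern_add, hleft, show -(l : ℤ) - N + (N : ℤ) = -(l : ℤ) by ring,
    show -(l : ℤ) - N + ((N + (l + r + 1) : ℕ) : ℤ) = 1 + r by push_cast; ring, hright]
  exact hint.hasSkeletonForm (by omega)

theorem exists_isSkeletonAt (hx : x ∈ goodSet c l d N M) (hN : 2 * d + 2 ≤ N) :
    ∃ a n, IsSkeletonAt N x 0 a n := by
  classical
  obtain ⟨a₀, n₀, h₀⟩ := exists_isSkeletonWindow hx hN
  have hex : ∃ n a, IsSkeletonWindow N x 0 a n := ⟨n₀, a₀, h₀⟩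
  obtain ⟨a, ha⟩ := Nat.find_spec hex
  exact ⟨a, _, ha, fun a' n' h' => Nat.find_min' hex ⟨a', h'⟩⟩

/-- The left delimiter ends before `p` and the right one begins after `q`. Being `N` long, they push
the ends of the window beyond the inspected blocks, whose non-zero symbols are then counted. Block
`l` is spare: it ensures that block 0 exists even when `l = 0`. -/
theorem le_skeletonLength_of_isSkeletonWindow (hx : x ∈ goodSet c l d N M)
    (hN : 2 * ((l + 1) * d) + 2 ≤ N) {a : ℤ} {n : ℕ} (h : IsSkeletonWindow N x 0 a n) :
    l ≤ skeletonLength x a n := by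
  obtain ⟨⟨p, hp1, hpd, hp⟩, q, hq1, hqd, hq⟩ := exists_ne_zero_of_mem_goodSet hx
  obtain ⟨ha, hn, hform⟩ := h
  obtain ⟨hz1, hz2⟩ := hform.zero_delimited
  have hd : d ≤ (l + 1) * d := Nat.le_mul_of_pos_left d (Nat.succ_pos l)
  have hleft : a + N ≤ p := by
    by_contra hcon
    apply hp
    rw [← hz1 (p - a).toNat (by omega)]; congr 1; omega
  have hright : q ≤ a + n - 1 - N := by
    by_contra hcon
    apply hq
    rw [← hz2 (a + n - 1 - q).toNat (by omega)]; congr 1; omega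
  choose! f hfd hf using hx.1.1
  have hlt : ∀ i < l, ((i * d + f i : ℕ) : ℤ) < ((l + 1) * d : ℕ) := by
    intro i hi
    have h1 := hfd i (by omega)
    have : (i + 1) * d ≤ (l + 1) * d := Nat.mul_le_mul_right d (by omega)
    rw [Nat.succ_mul] at this
    omega
  have hcard := Finset.card_le_card_of_injOn (s := Finset.range l)
    (t := (Finset.range n).filter fun k : ℕ => x (a + (k : ℤ)) ≠ 0)
    (fun i => (1 + ((i * d + f i : ℕ) : ℤ) - a).toNat) ?_ ?_
  · simpa [skeletonLength] using hcard
  · intro i hi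
    have hi' : i < l := by simpa using hi
    have := hlt i hi'
    have he : a + (((1 + ((i * d + f i : ℕ) : ℤ) - a).toNat : ℕ) : ℤ) =
        1 + ((i * d + f i : ℕ) : ℤ) := by omega
    rw [Finset.mem_coe, Finset.mem_filter, Finset.mem_range]
    beta_reduce
    rw [he]
    exact ⟨by omega, hf i (by omega)⟩
  · intro i hi j hj hij
    have hi' : i < l := by simpa using hi
    have hj' : j < l := by simpa using hj
    have h1 := hlt i hi'
    have h2 := hlt j hj'
    have h3 := hfd i (by omega)
    have h4 := hfd j (by omega)
    have h5 : i * d + f i = j * d + f j := by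
      simp only at hij
      omega
    -- Division by `d` recovers the index of the block from the position.
    have hdpos : 0 < d := by omega
    have e1 : (i * d + f i) / d = i := by
      rw [mul_comm, Nat.mul_add_div hdpos, Nat.div_eq_of_lt h3, add_zero]
    have e2 : (j * d + f j) / d = j := by
      rw [mul_comm, Nat.mul_add_div hdpos, Nat.div_eq_of_lt h4, add_zero]
    rw [← e1, ← e2, h5]

end

/-! ### Probabilities of blocks of zeros -/

/-- The sequences with a block of `n` zeros from position `k` on. -/
def zeros (c : ℕ) (k : ℤ) (n : ℕ) : Set (Seq c) :=
  {x | ∀ i < n, x (k + (i : ℤ)) = 0}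

theorem measurableSet_coord {c : ℕ} (k : ℤ) (a : Fin (c + 1)) :
    MeasurableSet {x : Seq c | x k = a} :=
  (measurable_pi_apply (X := fun _ : ℤ => Fin (c + 1)) k) (measurableSet_singleton a)

theorem measurableSet_zeros (c : ℕ) (k : ℤ) (n : ℕ) : MeasurableSet (zeros c k n) := by
  have : zeros c k n = ⋂ i ∈ Set.Iio n, {x | x (k + (i : ℤ)) = 0} := by
    ext x; simp [zeros]
  rw [this]
  exact MeasurableSet.biInter (Set.to_countable _) fun i _ => measurableSet_coord _ _

theorem measurableSet_cyl {c : ℕ} (n : ℕ) (w : List (Fin (c + 1))) : MeasurableSet (cyl n w) := by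
  have : cyl n w = ⋂ i : Fin w.length, {x | x ((i : ℤ) - (n : ℤ)) = w.get i} := by
    ext x; simp [cyl]
  rw [this]
  exact MeasurableSet.iInter fun i => measurableSet_coord _ _

theorem shift_iterate {c : ℕ} (n : ℕ) (x : Seq c) (i : ℤ) : shift^[n] x i = x (i + n) := by
  induction n generalizing x with
  | zero => simp
  | succ n ih =>
    rw [Function.iterate_succ_apply, ih]
    simp [shift, add_assoc]

theorem measure_cyl {c : ℕ} {μ : Measure (Seq c)} (hμ : MeasurePreserving shift μ μ) (n : ℕ)
    (w : List (Fin (c + 1))) : μ (cyl n w) = μ (cyl 0 w) := by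
  rw [← (hμ.iterate n).measure_preimage (measurableSet_cyl n w).nullMeasurableSet]
  congr 1
  ext x
  simp [cyl, shift_iterate]

theorem measure_zeros {c : ℕ} {μ : Measure (Seq c)} (hμ : MeasurePreserving shift μ μ) (k : ℤ)
    (n : ℕ) : μ (zeros c k n) = μ (cyl 0 (List.replicate n 0)) := by
  have hstep : ∀ k : ℤ, μ (zeros c (k + 1) n) = μ (zeros c k n) := by
    intro k
    rw [← hμ.measure_preimage (measurableSet_zeros c k n).nullMeasurableSet]
    congr 1
    ext x
    simp only [zeros, shift, Set.mem_ofPred_eq, Set.mem_preimage]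
    refine forall₂_congr fun i _ => ?_
    rw [add_right_comm]
  have h0 : μ (zeros c k n) = μ (zeros c 0 n) := by
    induction k using Int.induction_on with
    | zero => rfl
    | succ k ih => rw [hstep, ih]
    | pred k ih => rw [← ih, ← hstep, sub_add_cancel]
  rw [h0]
  congr 1
  ext x
  simp only [zeros, cyl, Set.mem_ofPred_eq, List.get_eq_getElem, List.getElem_replicate,
    Fin.forall_iff, List.length_replicate]
  simp

section

variable {c : ℕ} {μ : Measure (Seq c)}

theorem measure_zeros_succ (hμ : IsMixingMarkov μ) (n : ℕ) :
    μ (cyl 0 (List.replicate (n + 2) 0)) * μ (cyl 0 [0]) =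
      μ (cyl 0 (List.replicate (n + 1) 0)) * μ (cyl 0 [0, 0]) := by
  have h := hμ.markov (List.replicate n 0) 0 0
  have e1 : List.replicate n (0 : Fin (c + 1)) ++ [0, 0] = List.replicate (n + 2) 0 := by
    rw [List.replicate_add]; rfl
  have e2 : List.replicate n (0 : Fin (c + 1)) ++ [0] = List.replicate (n + 1) 0 := by
    rw [List.replicate_add]; rfl
  rwa [e1, e2] at h

theorem measure_zeros_pos (hμ : IsMixingMarkov μ) (h00_pos : 0 < μ (cyl 0 [0, 0])) (n : ℕ) :
    0 < μ (cyl 0 (List.replicate n 0)) := by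
  have := hμ.prob
  have h0 : 0 < μ (cyl 0 [0]) := h00_pos.trans_le (measure_mono fun x hx i => by
    have h := hx ⟨0, by simp⟩
    have hi : i = ⟨0, by simp⟩ := Subsingleton.elim (α := Fin 1) _ _
    subst hi
    simpa using h)
  have key : ∀ n, 0 < μ (cyl 0 (List.replicate (n + 1) 0)) := by
    intro n
    induction n with
    | zero => exact h0
    | succ n ih =>
      have h := measure_zeros_succ hμ n
      have hne : μ (cyl 0 (List.replicate (n + 1) 0)) * μ (cyl 0 [0, 0]) ≠ 0 :=
        mul_ne_zero ih.ne' h00_pos.ne'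
      rw [← h] at hne
      exact pos_iff_ne_zero.2 (left_ne_zero_of_mul hne)
  cases n with
  | zero =>
    refine (key 0).trans_le (measure_mono fun x _ i => ?_)
    exact i.elim0
  | succ n => exact key n

/-- The Markov recursion gives `P(0ⁿ⁺¹) = P(0) ρⁿ` with `ρ = P(00) / P(0) < 1`. -/
theorem tendsto_measure_zeros (hμ : IsMixingMarkov μ)
    (h00_lt : μ (cyl 0 [0, 0]) < μ (cyl 0 [0])) :
    Tendsto (fun n => μ (cyl 0 (List.replicate n 0))) atTop (𝓝 0) := by
  have := hμ.prob
  have h0 : μ (cyl 0 [0]) ≠ 0 := (pos_of_gt h00_lt).ne'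
  have h0' : μ (cyl 0 [0]) ≠ ∞ := measure_ne_top _ _
  have hrho : μ (cyl 0 [0, 0]) / μ (cyl 0 [0]) < 1 := by
    rw [ENNReal.div_lt_iff (Or.inl h0) (Or.inl h0'), one_mul]
    exact h00_lt
  have key : ∀ n, μ (cyl 0 (List.replicate (n + 1) 0)) =
      μ (cyl 0 [0]) * (μ (cyl 0 [0, 0]) / μ (cyl 0 [0])) ^ n := by
    intro n
    induction n with
    | zero => simp
    | succ n ih =>
      have h := measure_zeros_succ hμ n
      rw [pow_succ, ← mul_assoc, ← ih, ← mul_div_assoc, ← h,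
        ENNReal.mul_div_cancel_right h0 h0']
  rw [← tendsto_add_atTop_iff_nat 1]
  simp only [key]
  have := ENNReal.Tendsto.const_mul (ENNReal.tendsto_pow_atTop_nhds_zero_of_lt_one hrho)
    (Or.inr h0' : (0 : ℝ≥0∞) ≠ 0 ∨ μ (cyl 0 [0]) ≠ ∞)
  simpa using this

/-- The sequences with no block of `N` zeros starting at `1 + j` for some `j < M`. -/
def noZerosRight (c N M : ℕ) : Set (Seq c) := ⋂ j ∈ Set.Iio M, (zeros c (1 + (j : ℤ)) N)ᶜ

/-- The sequences with no block of `N` zeros ending at `-1 - j` for some `j < M`. -/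
def noZerosLeft (c N M : ℕ) : Set (Seq c) := ⋂ j ∈ Set.Iio M, (zeros c (-(j : ℤ) - N) N)ᶜ

theorem measurableSet_noZerosRight (c N M : ℕ) : MeasurableSet (noZerosRight c N M) :=
  MeasurableSet.biInter (Set.to_countable _) fun _ _ => (measurableSet_zeros _ _ _).compl

theorem measurableSet_noZerosLeft (c N M : ℕ) : MeasurableSet (noZerosLeft c N M) :=
  MeasurableSet.biInter (Set.to_countable _) fun _ _ => (measurableSet_zeros _ _ _).compl

/-- Let `B` be the event that no run of `N` zeros ever starts to the right of 0. It is disjoint from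
every shifted run event, so mixing yields `P(B) P(0ᴺ) = 0`. As `P(0ᴺ) > 0`, `B` is null, and
continuity from above concludes. -/
theorem tendsto_measure_noZerosRight (hμ : IsMixingMarkov μ) (h00_pos : 0 < μ (cyl 0 [0, 0]))
    (N : ℕ) : Tendsto (fun M => μ (noZerosRight c N M)) atTop (𝓝 0) := by
  have := hμ.prob
  have hB : MeasurableSet (⋂ M, noZerosRight c N M) :=
    MeasurableSet.iInter fun M => measurableSet_noZerosRight c N M
  have hlim := hμ.mixing _ _ hB (measurableSet_zeros c 0 N)
  have hzero : ∀ n, 1 ≤ n →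
      μ ((⋂ M, noZerosRight c N M) ∩ shift^[n] ⁻¹' zeros c 0 N) = 0 := by
    intro n hn
    convert measure_empty (μ := μ)
    rw [Set.eq_empty_iff_forall_notMem]
    rintro x ⟨hx, hz⟩
    simp only [noZerosRight, Set.mem_iInter] at hx
    refine hx n (n - 1) (show n - 1 < n by omega) fun i hi => ?_
    have := hz i hi
    rw [shift_iterate] at this
    rw [← this]; congr 1; omega
  have hprod : μ (⋂ M, noZerosRight c N M) * μ (zeros c 0 N) = 0 :=
    tendsto_nhds_unique hlim (tendsto_const_nhds.congr'
      ((eventually_ge_atTop 1).mono fun n hn => (hzero n hn).symm))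
  have hμB : μ (⋂ M, noZerosRight c N M) = 0 := by
    refine (mul_eq_zero.1 hprod).resolve_right ?_
    rw [measure_zeros hμ.stationary]
    exact (measure_zeros_pos hμ h00_pos N).ne'
  rw [← hμB]
  refine tendsto_measure_iInter_atTop
    (fun M => (measurableSet_noZerosRight c N M).nullMeasurableSet) ?_ ⟨0, measure_ne_top _ _⟩
  intro M M' h
  exact Set.biInter_subset_biInter_left (Set.Iio_subset_Iio h)

theorem tendsto_measure_noZerosLeft (hμ : IsMixingMarkov μ) (h00_pos : 0 < μ (cyl 0 [0, 0]))
    (N : ℕ) : Tendsto (fun M => μ (noZerosLeft c N M)) atTop (𝓝 0) := by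
  have := hμ.prob
  have hB : MeasurableSet (⋂ M, noZerosLeft c N M) :=
    MeasurableSet.iInter fun M => measurableSet_noZerosLeft c N M
  have hlim := hμ.mixing _ _ (measurableSet_zeros c 0 N) hB
  have hzero : ∀ n, N ≤ n →
      -- Here the roles are exchanged: the event without runs is shifted, and seen from position `n`
      -- the zeros at `0, …, N - 1` form a run on the left.
      μ (zeros c 0 N ∩ shift^[n] ⁻¹' (⋂ M, noZerosLeft c N M)) = 0 := by
    intro n hn
    convert measure_empty (μ := μ)
    rw [Set.eq_empty_iff_forall_notMem]
    rintro x ⟨hz, hx⟩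
    simp only [noZerosLeft, Set.mem_iInter, Set.mem_preimage] at hx
    refine hx (n + 1) (n - N) (show n - N < n + 1 by omega) fun i hi => ?_
    rw [shift_iterate, ← hz i hi]
    congr 1; omega
  have hprod : μ (zeros c 0 N) * μ (⋂ M, noZerosLeft c N M) = 0 :=
    tendsto_nhds_unique hlim (tendsto_const_nhds.congr'
      ((eventually_ge_atTop N).mono fun n hn => (hzero n hn).symm))
  have hμB : μ (⋂ M, noZerosLeft c N M) = 0 := by
    refine (mul_eq_zero.1 hprod).resolve_left ?_
    rw [measure_zeros hμ.stationary]
    exact (measure_zeros_pos hμ h00_pos N).ne'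
  rw [← hμB]
  refine tendsto_measure_iInter_atTop
    (fun M => (measurableSet_noZerosLeft c N M).nullMeasurableSet) ?_ ⟨0, measure_ne_top _ _⟩
  intro M M' h
  exact Set.biInter_subset_biInter_left (Set.Iio_subset_Iio h)

theorem compl_goodSet_subset (l d N M : ℕ) :
    (goodSet c l d N M)ᶜ ⊆
      (((⋃ i ∈ Finset.range (l + 1), zeros c (1 + ((i * d : ℕ) : ℤ)) d) ∪ zeros c (-(d : ℤ)) d) ∪
        (noZerosRight c N M ∪ noZerosLeft c N M)) := by
  intro x hx
  by_contra hcon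
  apply hx
  simp only [Set.mem_union, not_or, Set.mem_iUnion, Finset.mem_range, not_exists] at hcon
  obtain ⟨⟨h1, h2⟩, h3, h4⟩ := hcon
  refine ⟨⟨fun i hi => ?_, ?_⟩, ?_, ?_⟩
  · by_contra h
    push Not at h
    refine h1 i hi fun j hj => ?_
    rw [← h j hj]; congr 1; push_cast; ring
  · by_contra h
    push Not at h
    refine h2 fun j hj => ?_
    rw [← h (d - 1 - j) (by omega)]; congr 1; omega
  · simp only [noZerosRight, Set.mem_iInter, not_forall] at h3
    obtain ⟨j, hj, h⟩ := h3
    refine ⟨j, hj, fun i hi => ?_⟩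
    rw [← (not_not.1 h) i hi]; congr 1; push_cast; ring
  · simp only [noZerosLeft, Set.mem_iInter, not_forall] at h4
    obtain ⟨j, hj, h⟩ := h4
    refine ⟨j, hj, fun i hi => ?_⟩
    rw [← (not_not.1 h) (N - 1 - i) (by omega)]; congr 1; omega

/-- The complement of a good set can be made arbitrarily small, even if `N` has to be a given
function of the length `d` of the blocks. -/
theorem exists_measure_compl_goodSet_lt (hμ : IsMixingMarkov μ) (h00_pos : 0 < μ (cyl 0 [0, 0]))
    (h00_lt : μ (cyl 0 [0, 0]) < μ (cyl 0 [0])) (l : ℕ) (N : ℕ → ℕ) {ε : ℝ≥0∞} (hε : ε ≠ 0) :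
    ∃ d M, μ (goodSet c l d (N d) M)ᶜ < ε := by
  -- The factor `l + 2` counts the `l + 1` blocks on the right and the one on the left. `M` is
  -- chosen last, so `N` may depend on `d`.
  have h1 := ENNReal.Tendsto.const_mul (tendsto_measure_zeros hμ h00_lt)
    (Or.inr (ENNReal.natCast_ne_top (l + 2)) : (0 : ℝ≥0∞) ≠ 0 ∨ ((l + 2 : ℕ) : ℝ≥0∞) ≠ ∞)
  rw [mul_zero] at h1
  have hhalf : 0 < ε / 2 := ENNReal.half_pos hε
  obtain ⟨d, hd⟩ := (h1.eventually (gt_mem_nhds hhalf)).exists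
  have h2 := (tendsto_measure_noZerosRight hμ h00_pos (N d)).add
    (tendsto_measure_noZerosLeft hμ h00_pos (N d))
  rw [add_zero] at h2
  obtain ⟨M, hM⟩ := (h2.eventually (gt_mem_nhds hhalf)).exists
  refine ⟨d, M, ?_⟩
  calc μ (goodSet c l d (N d) M)ᶜ
      ≤ μ ((⋃ i ∈ Finset.range (l + 1), zeros c (1 + ((i * d : ℕ) : ℤ)) d) ∪ zeros c (-(d : ℤ)) d)
          + μ (noZerosRight c (N d) M ∪ noZerosLeft c (N d) M) :=
        (measure_mono (compl_goodSet_subset l d (N d) M)).trans (measure_union_le _ _)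
    _ ≤ ((l + 2 : ℕ) : ℝ≥0∞) * μ (cyl 0 (List.replicate d 0))
          + (μ (noZerosRight c (N d) M) + μ (noZerosLeft c (N d) M)) := by
        refine add_le_add ?_ (measure_union_le _ _)
        refine (measure_union_le _ _).trans ?_
        rw [show l + 2 = l + 1 + 1 from rfl, Nat.cast_succ (l + 1), add_mul, one_mul,
          measure_zeros hμ.stationary]
        gcongr
        refine (measure_biUnion_finset_le _ _).trans ?_
        simp only [measure_zeros hμ.stationary]
        simp
    _ < ε / 2 + ε / 2 := ENNReal.add_lt_add hd hM
    _ = ε := ENNReal.add_halves ε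

end

/-! ### Good sets as computable clopen sets -/

/-- All words of a given length. -/
def words (c : ℕ) (k : ℕ) : List (List (Fin (c + 1))) :=
  Nat.rec [[]] (fun _ W => W.flatMap fun w => (List.finRange (c + 1)).map fun a => a :: w) k

theorem words_succ (c k : ℕ) :
    words c (k + 1) = (words c k).flatMap fun w => (List.finRange (c + 1)).map fun a => a :: w :=
  rfl

theorem mem_words {c k : ℕ} {w : List (Fin (c + 1))} : w ∈ words c k ↔ w.length = k := by
  induction k generalizing w with
  | zero => simp [words]
  | succ k ih =>
    rw [words_succ]
    cases w with
    | nil => simp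
    | cons a w => simp [ih]

theorem nodup_words (c k : ℕ) : (words c k).Nodup := by
  induction k with
  | zero => simp [words]
  | succ k ih =>
    rw [words_succ, List.nodup_flatMap]
    refine ⟨fun w _ => (List.nodup_finRange _).map fun a b h => by simpa using h, ?_⟩
    refine ih.imp fun {v w} hvw => ?_
    simp only [Function.onFun, List.disjoint_left, List.mem_map]
    rintro _ ⟨a, -, rfl⟩ ⟨b, -, h⟩
    simp only [List.cons.injEq] at h
    exact hvw h.2.symm

theorem primrec_words (c : ℕ) : Primrec (words c) := by
  have hmap : Primrec₂ fun (_ : ℕ × List (List (Fin (c + 1)))) (w : List (Fin (c + 1))) =>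
      (List.finRange (c + 1)).map fun a => a :: w :=
    Primrec.list_map (Primrec.const _) (Primrec.list_cons.comp Primrec.snd
      (Primrec.snd.comp Primrec.fst))
  have hstep : Primrec₂ fun (_ : ℕ) (W : List (List (Fin (c + 1)))) =>
      W.flatMap fun w => (List.finRange (c + 1)).map fun a => a :: w :=
    Primrec.list_flatMap Primrec.snd hmap
  exact Primrec.nat_rec₁ _ hstep

/-- The word read by `x` on the positions `-R, …, R`. -/
def readWord {c : ℕ} (x : Seq c) (R : ℕ) : List (Fin (c + 1)) :=
  (List.range (2 * R + 1)).map fun i : ℕ => x ((i : ℤ) - R)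

theorem mem_cyl_iff {c : ℕ} {x : Seq c} {R : ℕ} {w : List (Fin (c + 1))}
    (hw : w.length = 2 * R + 1) : x ∈ cyl R w ↔ readWord x R = w := by
  constructor
  · intro h
    refine List.ext_get (by simp [readWord, hw]) fun i h1 h2 => ?_
    simpa [readWord] using h ⟨i, h2⟩
  · rintro rfl i
    rw [List.get_eq_getElem]
    simp only [readWord, List.getElem_map, List.getElem_range]

/-- `Good` for the sequences that read `w` on the positions `-R, …, R`, with `R` the radius of the
parameters `q = (l, d, N, M)`. -/
def GoodWord {c : ℕ} (w : List (Fin (c + 1))) (q : ℕ × ℕ × ℕ × ℕ) : Prop :=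
  Good q.1 q.2.1 q.2.2.1 q.2.2.2
    (fun k => w[radius q.1 q.2.1 q.2.2.1 q.2.2.2 + 1 + k]? = some 0)
    (fun k => w[radius q.1 q.2.1 q.2.2.1 q.2.2.2 - 1 - k]? = some 0)

theorem readWord_getElem? {c : ℕ} (x : Seq c) {R i : ℕ} (hi : i ≤ 2 * R) :
    (readWord x R)[i]? = some (x ((i : ℤ) - R)) := by
  simp only [readWord, List.getElem?_map]
  rw [List.getElem?_range (by omega)]
  rfl

theorem goodWord_readWord {c : ℕ} (x : Seq c) (q : ℕ × ℕ × ℕ × ℕ) :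
    GoodWord (readWord x (radius q.1 q.2.1 q.2.2.1 q.2.2.2)) q ↔
      x ∈ goodSet c q.1 q.2.1 q.2.2.1 q.2.2.2 := by
  unfold GoodWord goodSet
  rw [Set.mem_ofPred_eq]
  -- Only `k` below the radius matters, so the truncated subtraction in `GoodWord` is a true one.
  refine Good.congr (fun k hk => ?_) fun k hk => ?_
  · rw [readWord_getElem? x (by omega), Option.some_inj]
    rw [iff_iff_eq]; congr 2; push_cast; ring
  · rw [readWord_getElem? x (by omega), Option.some_inj]
    rw [iff_iff_eq]; congr 2; omega

/-! ### Primitive recursiveness of the good condition -/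

theorem PrimrecPred.forall_lt_comp {α : Type} [Primcodable α] {f : α → ℕ} {p : α × ℕ → Prop}
    (hf : Primrec f) (hp : PrimrecPred p) : PrimrecPred fun a => ∀ i < f a, p (a, i) := by
  have hR : PrimrecRel fun (i : ℕ) (a : α) => p (a, i) := hp.comp (Primrec.snd.pair Primrec.fst)
  exact (hR.forall_mem_list.comp (Primrec.list_range.comp hf) Primrec.id).of_eq
    fun a => by simp

theorem PrimrecPred.exists_lt_comp {α : Type} [Primcodable α] {f : α → ℕ} {p : α × ℕ → Prop}
    (hf : Primrec f) (hp : PrimrecPred p) : PrimrecPred fun a => ∃ i < f a, p (a, i) := by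
  have hR : PrimrecRel fun (i : ℕ) (a : α) => p (a, i) := hp.comp (Primrec.snd.pair Primrec.fst)
  exact (hR.exists_mem_list.comp (Primrec.list_range.comp hf) Primrec.id).of_eq
    fun a => by simp

theorem primrec_radius {α : Type} [Primcodable α] {l d N M : α → ℕ} (hl : Primrec l)
    (hd : Primrec d) (hN : Primrec N) (hM : Primrec M) :
    Primrec fun a => radius (l a) (d a) (N a) (M a) :=
  Primrec.nat_add.comp (Primrec.nat_add.comp
    (Primrec.nat_mul.comp (Primrec.succ.comp hl) hd) hM) hN

theorem primrecPred_good {α : Type} [Primcodable α] {l d N M : α → ℕ} {zr zl : α × ℕ → Prop}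
    (hl : Primrec l) (hd : Primrec d) (hN : Primrec N) (hM : Primrec M)
    (hzr : PrimrecPred zr) (hzl : PrimrecPred zl) :
    PrimrecPred fun a =>
      Good (l a) (d a) (N a) (M a) (fun k => zr (a, k)) (fun k => zl (a, k)) := by
  have hblock : ∀ {z : α × ℕ → Prop}, PrimrecPred z →
      PrimrecPred fun a => ∃ j < M a, ∀ i < N a, z (a, j + i) := by
    intro z hz
    refine PrimrecPred.exists_lt_comp (p := fun b : α × ℕ => ∀ i < N b.1, z (b.1, b.2 + i)) hM ?_
    refine PrimrecPred.forall_lt_comp (p := fun b : (α × ℕ) × ℕ => z (b.1.1, b.1.2 + b.2))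
      (hN.comp Primrec.fst) ?_
    exact hz.comp ((Primrec.fst.comp Primrec.fst).pair
      (Primrec.nat_add.comp (Primrec.snd.comp Primrec.fst) Primrec.snd))
  refine PrimrecPred.and (PrimrecPred.and ?_ ?_) (PrimrecPred.and (hblock hzr) (hblock hzl))
  · refine PrimrecPred.forall_lt_comp
      (p := fun b : α × ℕ => ∃ j < d b.1, ¬ zr (b.1, b.2 * d b.1 + j)) (Primrec.succ.comp hl) ?_
    refine PrimrecPred.exists_lt_comp
      (p := fun b : (α × ℕ) × ℕ => ¬ zr (b.1.1, b.1.2 * d b.1.1 + b.2)) (hd.comp Primrec.fst) ?_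
    exact (hzr.comp ((Primrec.fst.comp Primrec.fst).pair
      (Primrec.nat_add.comp (Primrec.nat_mul.comp (Primrec.snd.comp Primrec.fst)
        (hd.comp (Primrec.fst.comp Primrec.fst))) Primrec.snd))).not
  · exact PrimrecPred.exists_lt_comp (p := fun b : α × ℕ => ¬ zl b) hd hzl.not

theorem primrecRel_goodWord (c : ℕ) :
    PrimrecRel (GoodWord : List (Fin (c + 1)) → ℕ × ℕ × ℕ × ℕ → Prop) := by
  let α := List (Fin (c + 1)) × (ℕ × ℕ × ℕ × ℕ)
  have hl : Primrec fun a : α => a.2.1 := Primrec.fst.comp Primrec.snd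
  have h2 : Primrec fun a : α => a.2.2 := Primrec.snd.comp Primrec.snd
  have hd : Primrec fun a : α => a.2.2.1 := Primrec.fst.comp h2
  have hN : Primrec fun a : α => a.2.2.2.1 := Primrec.fst.comp (Primrec.snd.comp h2)
  have hM : Primrec fun a : α => a.2.2.2.2 := Primrec.snd.comp (Primrec.snd.comp h2)
  have hR := primrec_radius hl hd hN hM
  have hget : ∀ {f : α × ℕ → ℕ}, Primrec f →
      PrimrecPred fun b : α × ℕ => b.1.1[f b]? = some 0 := fun hf =>
    Primrec.eq.comp (Primrec.list_getElem?.comp (Primrec.fst.comp Primrec.fst) hf)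
      (Primrec.const _)
  exact primrecPred_good hl hd hN hM
    (hget (Primrec.nat_add.comp (Primrec.succ.comp (hR.comp Primrec.fst)) Primrec.snd))
    (hget (Primrec.nat_sub.comp (Primrec.nat_sub.comp (hR.comp Primrec.fst) (Primrec.const 1))
      Primrec.snd))

/-- The codes of the cylinders that make up the complement of a good set. -/
def IsBadCode {c : ℕ} (q : ℕ × ℕ × ℕ × ℕ) (p : ℕ × List (Fin (c + 1))) : Prop :=
  p.1 = radius q.1 q.2.1 q.2.2.1 q.2.2.2 ∧ p.2.length = 2 * p.1 + 1 ∧ ¬ GoodWord p.2 q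

theorem primrec_radius_params :
    Primrec fun q : ℕ × ℕ × ℕ × ℕ => radius q.1 q.2.1 q.2.2.1 q.2.2.2 :=
  primrec_radius Primrec.fst (Primrec.fst.comp Primrec.snd)
    (Primrec.fst.comp (Primrec.snd.comp Primrec.snd))
    (Primrec.snd.comp (Primrec.snd.comp Primrec.snd))

theorem primrecRel_isBadCode (c : ℕ) :
    PrimrecRel (IsBadCode : ℕ × ℕ × ℕ × ℕ → ℕ × List (Fin (c + 1)) → Prop) := by
  refine PrimrecPred.and ?_ (PrimrecPred.and ?_ (PrimrecPred.not ?_))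
  · exact Primrec.eq.comp (Primrec.fst.comp Primrec.snd) (primrec_radius_params.comp Primrec.fst)
  · exact Primrec.eq.comp (Primrec.list_length.comp (Primrec.snd.comp Primrec.snd))
      (Primrec.succ.comp (Primrec.nat_mul.comp (Primrec.const 2)
        (Primrec.fst.comp Primrec.snd)))
  · exact (primrecRel_goodWord c).comp (Primrec.snd.comp Primrec.snd) Primrec.fst

theorem compl_goodSet_eq_iUnion (c : ℕ) (q : ℕ × ℕ × ℕ × ℕ) :
    (goodSet c q.1 q.2.1 q.2.2.1 q.2.2.2)ᶜ =
      ⋃ p ∈ {p : ℕ × List (Fin (c + 1)) | IsBadCode q p}, cyl p.1 p.2 := by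
  ext x
  simp only [Set.mem_iUnion]
  constructor
  · intro hx
    refine ⟨(radius q.1 q.2.1 q.2.2.1 q.2.2.2, readWord x (radius q.1 q.2.1 q.2.2.1 q.2.2.2)),
      ⟨rfl, by simp [readWord], ?_⟩, ?_⟩
    · rwa [goodWord_readWord]
    · rw [mem_cyl_iff (by simp [readWord])]
  · rintro ⟨⟨n, w⟩, ⟨h1, h2, h3⟩, hx⟩ hx'
    rw [mem_cyl_iff h2] at hx
    simp only at h1 h3 hx
    rw [← hx, h1, goodWord_readWord] at h3
    exact h3 hx'

open Classical in
/-- The words whose cylinders make up the complement of a good set. -/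
noncomputable def badWords (c : ℕ) (q : ℕ × ℕ × ℕ × ℕ) : List (List (Fin (c + 1))) :=
  (words c (2 * radius q.1 q.2.1 q.2.2.1 q.2.2.2 + 1)).filter fun w => ¬ GoodWord w q

theorem primrec_badWords (c : ℕ) : Primrec (badWords c) := by
  classical
  exact ((primrecRel_goodWord c).not.listFilter).comp
    ((primrec_words c).comp (Primrec.succ.comp
      (Primrec.nat_mul.comp (Primrec.const 2) primrec_radius_params))) Primrec.id

/-- Distinct words of the same length give disjoint cylinders at the same place, and stationarity
moves each of them to position 0. -/
theorem measure_compl_goodSet {c : ℕ} {μ : Measure (Seq c)} (hμ : MeasurePreserving shift μ μ)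
    [IsProbabilityMeasure μ] (q : ℕ × ℕ × ℕ × ℕ) :
    (μ (goodSet c q.1 q.2.1 q.2.2.1 q.2.2.2)ᶜ).toNNReal =
      ((badWords c q).map fun w => (μ (cyl 0 w)).toNNReal).sum := by
  classical
  have hlen : ∀ w ∈ badWords c q, w.length = 2 * radius q.1 q.2.1 q.2.2.1 q.2.2.2 + 1 := by
    intro w hw
    exact mem_words.1 (List.mem_of_mem_filter hw)
  have hunion : (goodSet c q.1 q.2.1 q.2.2.1 q.2.2.2)ᶜ =
      ⋃ w ∈ (badWords c q).toFinset, cyl (radius q.1 q.2.1 q.2.2.1 q.2.2.2) w := by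
    ext x
    simp only [Set.mem_iUnion, List.mem_toFinset]
    constructor
    · intro hx
      refine ⟨readWord x (radius q.1 q.2.1 q.2.2.1 q.2.2.2), ?_, ?_⟩
      · rw [badWords, List.mem_filter, mem_words]
        exact ⟨by simp [readWord], by simpa [goodWord_readWord] using hx⟩
      · rw [mem_cyl_iff (by simp [readWord])]
    · rintro ⟨w, hw, hx⟩
      rw [mem_cyl_iff (hlen w hw)] at hx
      have h := List.of_mem_filter hw
      rw [← hx] at h
      simpa [goodWord_readWord] using h
  have hdisj : Set.PairwiseDisjoint (↑(badWords c q).toFinset)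
      (cyl (c := c) (radius q.1 q.2.1 q.2.2.1 q.2.2.2)) := by
    intro v hv w hw hvw
    rw [Finset.mem_coe, List.mem_toFinset] at hv hw
    refine Set.disjoint_left.2 fun x hxv hxw => hvw ?_
    rw [mem_cyl_iff (hlen _ hv)] at hxv
    rw [mem_cyl_iff (hlen _ hw)] at hxw
    rw [← hxv, ← hxw]
  have hnodup : (badWords c q).Nodup := (nodup_words _ _).filter _
  rw [hunion, measure_biUnion_finset hdisj fun w _ => measurableSet_cyl _ _,
    ENNReal.toNNReal_sum fun w _ => measure_ne_top _ _, List.sum_toFinset _ hnodup]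
  simp only [measure_cyl hμ]

theorem uniformlyComputableReal_measure_compl_goodSet {c : ℕ} {μ : Measure (Seq c)}
    (hμ : IsMixingMarkov μ) (hμ_comp : ComputableWordProbabilities μ) :
    UniformlyComputableReal fun q : ℕ × ℕ × ℕ × ℕ =>
      (μ (goodSet c q.1 q.2.1 q.2.2.1 q.2.2.2)ᶜ).toNNReal := by
  have := hμ.prob
  simp only [measure_compl_goodSet hμ.stationary]
  exact hμ_comp.list_sum (primrec_badWords c).to_comp

theorem rePred_of_primrecRel {α β γ : Type} [Primcodable α] [Primcodable β] [Primcodable γ]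
    {R : β → γ → Prop} (hR : PrimrecRel R) {f : α → β} {g : α → γ} (hf : Computable f)
    (hg : Computable g) : REPred fun a => R (f a) (g a) := by
  obtain ⟨D, h⟩ := hR
  exact ComputablePred.to_re ⟨fun a => D (f a, g a), h.to_comp.comp (hf.pair hg)⟩

theorem uniformlyEffectivelyOpen_compl_goodSet (c : ℕ) {q : ℕ → ℕ × ℕ × ℕ × ℕ}
    (hq : Computable q) :
    UniformlyEffectivelyOpen fun r =>
      (goodSet c (q r).1 (q r).2.1 (q r).2.2.1 (q r).2.2.2)ᶜ :=
  ⟨fun p => IsBadCode (q p.1) p.2,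
    rePred_of_primrecRel (primrecRel_isBadCode c) (hq.comp Computable.fst) Computable.snd,
    fun r => compl_goodSet_eq_iUnion c (q r)⟩

/-! ### Computable choice of the parameters -/

/-- The number of zeros that delimit a skeleton: larger than `k`, and larger than the part of the
sequence in which blocks of `d` symbols are inspected. -/
def delimiter (l d k : ℕ) : ℕ := 2 * ((l + 1) * d) + 2 + k

theorem computable_delimiter {α : Type} [Primcodable α] {l d k : α → ℕ} (hl : Computable l)
    (hd : Computable d) (hk : Computable k) :
    Computable fun a => delimiter (l a) (d a) (k a) :=
  Primrec.nat_add.to_comp.comp (Computable.succ.comp (Computable.succ.comp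
    (Primrec.nat_mul.to_comp.comp (Computable.const 2)
      (Primrec.nat_mul.to_comp.comp (Computable.succ.comp hl) hd)))) hk

/-- Computable parameters for the layers, with strictly increasing delimiters. -/
theorem exists_computable_parameters {c : ℕ} {μ : Measure (Seq c)} (hμ : IsMixingMarkov μ)
    (hμ_comp : ComputableWordProbabilities μ) (h00_pos : 0 < μ (cyl 0 [0, 0]))
    (h00_lt : μ (cyl 0 [0, 0]) < μ (cyl 0 [0])) {L : ℕ → ℕ} (hL : Computable L) :
    ∃ d N M : ℕ → ℕ, Computable d ∧ Computable N ∧ Computable M ∧ StrictMono N ∧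
      (∀ r, 2 * ((L r + 1) * d r) + 2 ≤ N r) ∧
      ∀ r, μ (goodSet c (L r) (d r) (N r) (M r))ᶜ < (2⁻¹ : ℝ≥0∞) ^ r := by
  have := hμ.prob
  -- The input is the rank, the previous delimiter and the code of a candidate pair `(d, M)`.
  let q : (ℕ × ℕ) × ℕ → ℕ × ℕ × ℕ × ℕ := fun a =>
    (L a.1.1, a.2.unpair.1, delimiter (L a.1.1) a.2.unpair.1 a.1.2, a.2.unpair.2)
  have hL1 : Computable fun a : (ℕ × ℕ) × ℕ => L a.1.1 :=
    hL.comp (Computable.fst.comp Computable.fst)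
  have hu : Computable fun a : (ℕ × ℕ) × ℕ => a.2.unpair :=
    Primrec.unpair.to_comp.comp Computable.snd
  have hq : Computable q :=
    hL1.pair ((Computable.fst.comp hu).pair
      ((computable_delimiter hL1 (Computable.fst.comp hu)
        (Computable.snd.comp Computable.fst)).pair (Computable.snd.comp hu)))
  have htoReal : ∀ (s : Set (Seq c)) (n : ℕ),
      ((μ s).toNNReal : ℝ) < (1 / 2 : ℝ) ^ n ↔ μ s < (2⁻¹ : ℝ≥0∞) ^ n := by
    intro s n
    have hpow : (2⁻¹ : ℝ≥0∞) ^ n = (((1 / 2 : ℝ≥0) ^ n : ℝ≥0) : ℝ≥0∞) := by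
      rw [one_div, ENNReal.coe_pow, ENNReal.coe_inv two_ne_zero, ENNReal.coe_ofNat]
    rw [hpow, ← ENNReal.coe_toNNReal (measure_ne_top μ s), ENNReal.coe_lt_coe,
      ← NNReal.coe_lt_coe]
    simp
  obtain ⟨s, hs, hsmall⟩ :=
    ((uniformlyComputableReal_measure_compl_goodSet hμ hμ_comp).comp hq).exists_computable_lt
      (e := Prod.fst) Computable.fst (fun a => by
        obtain ⟨d, M, h⟩ := exists_measure_compl_goodSet_lt hμ h00_pos h00_lt (L a.1)
          (fun d => delimiter (L a.1) d a.2) (ε := (2⁻¹ : ℝ≥0∞) ^ (a.1 + 2)) (by simp)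
        refine ⟨Nat.pair d M, ?_⟩
        rw [htoReal]
        simpa [q] using h)
  let step : ℕ → ℕ → ℕ := fun r k => delimiter (L r) (s (r, k)).unpair.1 k
  have hstep : Computable₂ step :=
    computable_delimiter (α := ℕ × ℕ) (hL.comp Computable.fst)
      (Computable.fst.comp (Primrec.unpair.to_comp.comp hs)) Computable.snd
  -- `κ r` is the delimiter preceding rank `r`, hence `N r = κ (r + 1)`; each step adds at least 2,
  -- so `N` increases strictly.
  let κ : ℕ → ℕ := fun r => Nat.rec 0 step r
  have hκ : Computable κ :=
    Computable.nat_rec (h := fun _ p => step p.1 p.2) Computable.id (Computable.const 0)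
      (hstep.comp (Computable.fst.comp Computable.snd) (Computable.snd.comp Computable.snd))
  have hκsucc : ∀ r, κ (r + 1) = delimiter (L r) (s (r, κ r)).unpair.1 (κ r) := fun _ => rfl
  have hv : Computable fun r => (s (r, κ r)).unpair :=
    Primrec.unpair.to_comp.comp (hs.comp (Computable.id.pair hκ))
  refine ⟨fun r => (s (r, κ r)).unpair.1, fun r => κ (r + 1), fun r => (s (r, κ r)).unpair.2,
    Computable.fst.comp hv, hκ.comp Computable.succ, Computable.snd.comp hv, ?_, ?_, ?_⟩
  · refine strictMono_nat_of_lt_succ fun r => ?_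
    rw [hκsucc (r + 1), delimiter]
    omega
  · intro r
    beta_reduce
    rw [hκsucc, delimiter]
    omega
  · intro r
    rw [← htoReal]
    exact hsmall (r, κ r)

theorem isSchnorrLayering_goodSet {c : ℕ} {μ : Measure (Seq c)} (hμ : IsMixingMarkov μ)
    (hμ_comp : ComputableWordProbabilities μ) {l d N M : ℕ → ℕ} (hl : Computable l)
    (hd : Computable d) (hN : Computable N) (hM : Computable M)
    (hlt : ∀ r, μ (goodSet c (l r) (d r) (N r) (M r))ᶜ < (2⁻¹ : ℝ≥0∞) ^ r) :
    IsSchnorrLayering μ fun r => goodSet c (l r) (d r) (N r) (M r) := by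
  have hq : Computable fun r => (l r, d r, N r, M r) := hl.pair (hd.pair (hN.pair hM))
  have hmeas : UniformlyComputableReal fun r =>
      (μ (goodSet c (l r) (d r) (N r) (M r))ᶜ).toNNReal := by
    have h := (uniformlyComputableReal_measure_compl_goodSet hμ hμ_comp).comp hq
    dsimp only at h
    exact h
  exact IsSchnorrTest.mk (uniformlyEffectivelyOpen_compl_goodSet c hq) hlt hmeas

end SchnorrSkeleton

theorem mainTheorem3 (c : ℕ) (μ : MeasureTheory.Measure (SchnorrSkeleton.Seq c))
    (hμ : SchnorrSkeleton.IsMixingMarkov μ)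
    (hμ_comp : SchnorrSkeleton.ComputableWordProbabilities μ)
    (h00_pos : 0 < μ (SchnorrSkeleton.cyl 0 [0, 0]))
    (h00_lt : μ (SchnorrSkeleton.cyl 0 [0, 0]) < μ (SchnorrSkeleton.cyl 0 [0]))
    (L : ℕ → ℕ) (hL_comp : Computable L)
    (hL_pos : ∀ r, 1 ≤ r → 0 < L r)
    (hL_incr : ∀ r, 1 ≤ r → L r ≤ L (r + 1)) :
    ∃ (K : ℕ → Set (SchnorrSkeleton.Seq c)) (N : ℕ → ℕ),
      SchnorrSkeleton.IsSchnorrLayering μ K ∧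
      Computable N ∧ StrictMono N ∧ (∀ r, 0 < N r) ∧
      ∀ r, 1 ≤ r → ∀ x ∈ K r,
        (∃ (a : ℤ) (n : ℕ), SchnorrSkeleton.IsSkeletonAt (N r) x 0 a n) ∧
        ∀ (a : ℤ) (n : ℕ), SchnorrSkeleton.IsSkeletonAt (N r) x 0 a n →
          L r ≤ SchnorrSkeleton.skeletonLength x a n := by
  obtain ⟨d, N, M, hd, hN, hM, hmono, hle, hlt⟩ :=
    SchnorrSkeleton.exists_computable_parameters hμ hμ_comp h00_pos h00_lt hL_comp
  refine ⟨fun r => SchnorrSkeleton.goodSet c (L r) (d r) (N r) (M r), N,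
    SchnorrSkeleton.isSchnorrLayering_goodSet hμ hμ_comp hL_comp hd hN hM hlt,
    hN, hmono, fun r => by have := hle r; omega, fun r _ x hx => ⟨?_, fun a n h => ?_⟩⟩
  · refine SchnorrSkeleton.exists_isSkeletonAt hx ?_
    have h1 := hle r
    have h2 : d r ≤ (L r + 1) * d r := Nat.le_mul_of_pos_left (d r) (Nat.succ_pos (L r))
    omega
  -- The bound holds for every window around 0, not only for a shortest one.
  · exact SchnorrSkeleton.le_skeletonLength_of_isSkeletonWindow hx (hle r) h.1
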